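/- Let $n,m\in\mathbb N$, $T>0$, let $U\subset\mathbb R^m$ be compact, and let $f:[0,T]\times\mathbb R^n\times U\to\mathbb R^n$ and $c:[0,T]\times\mathbb R^n\times U\to\mathbb R$ be continuous, $g:\mathbb R^n\to\mathbb R$. Suppose that there are constants $\alpha_f,\alpha_c,\alpha_g,\beta_f,\beta_c,\beta_g>0$ such that, for all $x,y\in\mathbb R^n$, $t\in[0,T]$ and $u\in U$, $$\|f(t,x,u)-f(t,y,u)\|\le\alpha_f\|x-y\|,\quad |c(t,x,u)-c(t,y,u)|\le\alpha_c\|x-y\|,\quad |g(x)-g(y)|\le\alpha_g\|x-y\|,$$ $$\|f(t,x,u)\|\le\beta_f(1+\|x\|),\quad |c(t,x,u)|\le\beta_c(1+\|x\|),\quad |g(x)|\le\beta_g(1+\|x\|),$$ where $\|\cdot\|$ is the Euclidean norm. For $(x_0,t_0)\in\mathbb R^n\times[0,T]$ let $$V^*(x_0,t_0)=\inf_{u,x}\int_{t_0}^T c(t,x(t),u(t))\,dt+g(x(T)),$$ where the infimum is over all measurable $u:[t_0,T]\to U$ with the corresponding (Carathéodory) solution $x$ of $\dot x(t)=f(t,x(t),u(t))$,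 $x(t_0)=x_0$ on $[t_0,T]$. Let $J\in C^2(\mathbb R^n\times\mathbb R,\mathbb R)$ and $x_0\in\mathbb R^n$, let $k_J:\mathbb R^n\times[0,T]\to U$ satisfy $$k_J(x,t)\in\operatorname*{arg\,min}_{u\in U}\{c(t,x,u)+\nabla_xJ(x,t)^{T}f(t,x,u)\}\quad\text{for all }(x,t)\in\mathbb R^n\times[0,T],$$ and let $x_J$ and the measurable input $u_J:[0,T]\to U$ satisfy $u_J(t)=k_J(x_J(t),t)$, $\dot x_J(t)=f(t,x_J(t),u_J(t))$ on $[0,T]$ and $x_J(0)=x_0$. Put $$R=(1+\|x_0\|)e^{\beta_fT}-1,\qquad C=2\max\{1,\;T,\;T\beta_f(1+\|x_0\|)e^{\beta_fT}\}.$$ Then $J-V^*\in W^{1,\infty}(B_R(0)\times[0,T])$, and the optimality gap $L(u_J,x_0)=\int_0^Tc(t,x_J(t),u_J(t))\,dt+g(x_J(T))-V^*(x_0,0)$ satisfies $$L(u_J,x_0)\le C\,\|J-V^*\|_{W^{1,\infty}(B_R(0)\times[0,T])}.$$ Here $B_R(0)$ is the open Euclidean ball and $\|w\|_{W^{1,\infty}(\Omega)}=\sum_{|\alpha|\le1}\operatorname{ess\,sup}_{\Omega}|D^\alpha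 w|$, with weak partial derivatives $D^\alpha$ in all $n+1$ variables $(x,t)$. -/

import Mathlib

open MeasureTheory Set

noncomputable section

/-- `ℝⁿ` with the Euclidean norm. -/
abbrev Vec (n : ℕ) : Type := EuclideanSpace ℝ (Fin n)

/-! ### Sobolev space `W^{1,∞}` on subsets of `ℝⁿ × ℝ` (space-time) -/

/-- `v` is a weak derivative of `w` on (the interior of) `Ω` in the direction `e`:
`∫_Ω w ∂_e φ = - ∫_Ω v φ` for all smooth `φ` with compact support in the interior of `Ω`. -/
def HasWeakDeriv {n : ℕ} (Ω : Set (Vec n × ℝ)) (w : Vec n × ℝ → ℝ) (e : Vec n × ℝ)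
    (v : Vec n × ℝ → ℝ) : Prop :=
  LocallyIntegrableOn w (interior Ω) ∧
  LocallyIntegrableOn v (interior Ω) ∧
  ∀ φ : Vec n × ℝ → ℝ, ContDiff ℝ (⊤ : ℕ∞) φ → HasCompactSupport φ →
    tsupport φ ⊆ interior Ω →
    ∫ z in Ω, w z * fderiv ℝ φ z e = - ∫ z in Ω, v z * φ z

open Classical in
/-- The weak derivative of `w` on `Ω` in the direction `e` (unique up to a null set on the
interior of `Ω`); zero if there is none. -/
def weakDeriv {n : ℕ} (Ω : Set (Vec n × ℝ)) (w : Vec n × ℝ → ℝ) (e : Vec n × ℝ) :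
    Vec n × ℝ → ℝ :=
  if h : ∃ v, HasWeakDeriv Ω w e v then Classical.choose h else 0

/-- The `i`-th spatial coordinate direction in `ℝⁿ × ℝ`. -/
def spaceDir {n : ℕ} (i : Fin n) : Vec n × ℝ := (EuclideanSpace.single i 1, 0)

/-- The time direction in `ℝⁿ × ℝ`. -/
def timeDir (n : ℕ) : Vec n × ℝ := (0, 1)

/-- Membership in `W^{1,∞}(Ω)`: `w` and all its first order weak partial derivatives exist and
are essentially bounded on `Ω`. -/
def MemW1Inf {n : ℕ} (Ω : Set (Vec n × ℝ)) (w : Vec n × ℝ → ℝ) : Prop :=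
  MemLp w ⊤ (volume.restrict Ω) ∧
  (∀ i : Fin n, ∃ v, HasWeakDeriv Ω w (spaceDir i) v ∧ MemLp v ⊤ (volume.restrict Ω)) ∧
  ∃ v, HasWeakDeriv Ω w (timeDir n) v ∧ MemLp v ⊤ (volume.restrict Ω)

/-- The norm `‖w‖_{W^{1,∞}(Ω)} = ∑_{|α| ≤ 1} ess sup_Ω |D^α w|` (for `w ∈ W^{1,∞}(Ω)`). -/
def w1InfNorm {n : ℕ} (Ω : Set (Vec n × ℝ)) (w : Vec n × ℝ → ℝ) : ℝ :=
  (eLpNorm w ⊤ (volume.restrict Ω)).toReal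
    + ∑ i : Fin n, (eLpNorm (weakDeriv Ω w (spaceDir i)) ⊤ (volume.restrict Ω)).toReal
    + (eLpNorm (weakDeriv Ω w (timeDir n)) ⊤ (volume.restrict Ω)).toReal

/-! ### Optimal control problems -/

/-- The data `{c, g, f, U, T}` of a finite-horizon optimal control problem. -/
structure OCP (n m : ℕ) where
  /-- running cost `c(t, x, u)` -/
  c : ℝ → Vec n → Vec m → ℝ
  /-- terminal cost `g(x)` -/
  g : Vec n → ℝ
  /-- dynamics `f(t, x, u)` -/
  f : ℝ → Vec n → Vec m → Vec n
  /-- input set -/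
  U : Set (Vec m)
  /-- time horizon -/
  T : ℝ

/-- Class `L` problems, with the constant `βf` in the linear growth bound on the dynamics. -/
structure OCP.IsClassL {n m : ℕ} (P : OCP n m) (βf : ℝ) : Prop where
  T_pos : 0 < P.T
  U_compact : IsCompact P.U
  f_cont : ContinuousOn (fun p : ℝ × Vec n × Vec m => P.f p.1 p.2.1 p.2.2)
    (Icc 0 P.T ×ˢ (univ ×ˢ P.U))
  c_cont : ContinuousOn (fun p : ℝ × Vec n × Vec m => P.c p.1 p.2.1 p.2.2)
    (Icc 0 P.T ×ˢ (univ ×ˢ P.U))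
  f_lip : ∃ αf : ℝ, 0 < αf ∧ ∀ t ∈ Icc 0 P.T, ∀ u ∈ P.U, ∀ x y : Vec n,
    ‖P.f t x u - P.f t y u‖ ≤ αf * ‖x - y‖
  c_lip : ∃ αc : ℝ, 0 < αc ∧ ∀ t ∈ Icc 0 P.T, ∀ u ∈ P.U, ∀ x y : Vec n,
    |P.c t x u - P.c t y u| ≤ αc * ‖x - y‖
  g_lip : ∃ αg : ℝ, 0 < αg ∧ ∀ x y : Vec n, |P.g x - P.g y| ≤ αg * ‖x - y‖
  βf_pos : 0 < βf
  f_growth : ∀ t ∈ Icc 0 P.T, ∀ u ∈ P.U, ∀ x : Vec n, ‖P.f t x u‖ ≤ βf * (1 + ‖x‖)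
  c_growth : ∃ βc : ℝ, 0 < βc ∧ ∀ t ∈ Icc 0 P.T, ∀ u ∈ P.U, ∀ x : Vec n,
    |P.c t x u| ≤ βc * (1 + ‖x‖)
  g_growth : ∃ βg : ℝ, 0 < βg ∧ ∀ x : Vec n, |P.g x| ≤ βg * (1 + ‖x‖)

/-- `(u, x)` is an admissible input together with its state trajectory on `[t₀, T]`, started at
`x₀`: `u` is (Lebesgue) measurable with values in `U`, and `x` is the Carathéodory solution of
`x' = f(t, x, u)`, `x(t₀) = x₀`. Only the values of `u`, `x` on `[t₀, T]` matter. -/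
structure OCP.Admissible {n m : ℕ} (P : OCP n m) (x₀ : Vec n) (t₀ : ℝ)
    (u : ℝ → Vec m) (x : ℝ → Vec n) : Prop where
  measurable : AEMeasurable u (volume.restrict (Icc t₀ P.T))
  mem : ∀ t ∈ Icc t₀ P.T, u t ∈ P.U
  continuous : ContinuousOn x (Icc t₀ P.T)
  integrable : IntervalIntegrable (fun s => P.f s (x s) (u s)) volume t₀ P.T
  eq : ∀ t ∈ Icc t₀ P.T, x t = x₀ + ∫ s in t₀..t, P.f s (x s) (u s)

/-- The cost of the input `u` with trajectory `x` on `[t₀, T]`. -/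
def OCP.cost {n m : ℕ} (P : OCP n m) (t₀ : ℝ) (u : ℝ → Vec m) (x : ℝ → Vec n) : ℝ :=
  (∫ t in t₀..P.T, P.c t (x t) (u t)) + P.g (x P.T)

/-- The value function `V*(x₀, t₀)`: the infimum of the cost over all admissible pairs. For class
`L` problems with nonempty `U` and `t₀ ∈ [0, T]` this is the infimum of a nonempty set of reals
that is bounded below. -/
def OCP.valueFunction {n m : ℕ} (P : OCP n m) (z : Vec n × ℝ) : ℝ :=
  sInf {r : ℝ | ∃ u x, P.Admissible z.1 z.2 u x ∧ r = P.cost z.2 u x}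

/-- The optimality gap `L(u, x₀)` of an input `u` on `[0, T]`; `x` is the state trajectory that
`u` generates from `x₀` (unique for class `L` problems). -/
def OCP.optimalityGap {n m : ℕ} (P : OCP n m) (u : ℝ → Vec m) (x : ℝ → Vec n)
    (x₀ : Vec n) : ℝ :=
  P.cost 0 u x - P.valueFunction (x₀, 0)

/-- `k` is a feedback law synthesized from `J`:
`k(x,t) ∈ argmin_{u ∈ U} { c(t,x,u) + ∇ₓJ(x,t)ᵀ f(t,x,u) }` for all `x` and `t ∈ [0, T]`. -/
def OCP.IsFeedback {n m : ℕ} (P : OCP n m) (J : Vec n × ℝ → ℝ)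
    (k : Vec n → ℝ → Vec m) : Prop :=
  ∀ x : Vec n, ∀ t ∈ Icc 0 P.T, k x t ∈ P.U ∧
    IsMinOn (fun v => P.c t x v + inner ℝ (gradient (fun y => J (y, t)) x) (P.f t x v))
      P.U (k x t)

end

/-! Put `w = J - V*`. Differentiating `J` along the trajectory generated by the feedback gives cost
`= J(x₀,0) - J(x(T),T) + g(x(T)) + ∫ (c + DJ(f,1))`. Since `V*(·,T) = g`, the gap is `w(x₀,0) -
w(x(T),T) + ∫ (c + DJ(f,1))`, so it remains to bound `w` pointwise and the integrand from above.

Only the inequality `min_u (c + DV*(f,1)) ≤ 0` of the Hamilton-Jacobi-Bellman equation is needed,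
and only where `V*` is differentiable (`exists_hjb_nonpos`). There some `u` satisfies `c + DJ(f,1) ≤
Dw(f,1)`, which the derivative part of the norm controls because `f` grows linearly. The feedback
minimizes over `u`, so it does no worse.

The trajectory is a null set and may miss every point of differentiability. However, `V*` is
Lipschitz on bounded sets (`exists_valueFunction_lipschitzOnWith`), so by Rademacher's theorem the
good points have full measure and are dense. Continuity in `(x,t)` and compactness of `U` carry the
Hamiltonian bound to their closure (`exists_hamiltonian_le`). The same Lipschitz property puts `w`
in `W^{1,∞}`. -/

open Filter Topology

/-! ### Grönwall's inequality and Carathéodory solutions. -/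

/-- Grönwall's inequality in integral form. -/
theorem le_mul_exp_of_le_add_integral {φ : ℝ → ℝ} {a b δ K : ℝ} (hK : 0 ≤ K)
    (hφ : ContinuousOn φ (Icc a b))
    (h : ∀ t ∈ Icc a b, φ t ≤ δ + K * ∫ s in a..t, φ s) :
    ∀ t ∈ Icc a b, φ t ≤ δ * Real.exp (K * (t - a)) := by
  intro t ht
  have hab : a ≤ b := ht.1.trans ht.2
  -- Extending `φ` constantly beyond `[a, b]` makes the majorant `δ + K ∫ ψ` differentiable
  -- everywhere. The differential Grönwall inequality applies to this majorant, not to `φ`, which is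
  -- merely continuous.
  set ψ : ℝ → ℝ := IccExtend hab ((Icc a b).domRestrict φ) with hψ
  have hψc : Continuous ψ := hφ.domRestrict.Icc_extend'
  have hψe : ∀ s ∈ Icc a b, ψ s = φ s := fun s hs => by
    rw [hψ, IccExtend_of_mem hab _ hs]; rfl
  have hint : ∀ t ∈ Icc a b, ∫ s in a..t, φ s = ∫ s in a..t, ψ s := fun t ht => by
    refine intervalIntegral.integral_congr fun s hs => ?_
    rw [uIcc_of_le ht.1] at hs
    exact (hψe s ⟨hs.1, hs.2.trans ht.2⟩).symm
  have hder : ∀ t, HasDerivAt (fun t => δ + K * ∫ s in a..t, ψ s) (K * ψ t) t := fun t =>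
    ((intervalIntegral.integral_hasDerivAt_right (hψc.intervalIntegrable _ _)
      hψc.aestronglyMeasurable.stronglyMeasurableAtFilter hψc.continuousAt).const_mul K).const_add δ
  have key := le_gronwallBound_of_liminf_deriv_right_le
    (f := fun t => δ + K * ∫ s in a..t, ψ s) (f' := fun t => K * ψ t) (δ := δ) (K := K) (ε := 0)
    (a := a) (b := b) (fun t _ => (hder t).continuousAt.continuousWithinAt)
    (fun x _ r hr => ((hder x).hasDerivWithinAt (s := Ici x)).liminf_right_slope_le hr)
    (by simp) (fun x hx => by
      have := h x ⟨hx.1, hx.2.le⟩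
      rw [hint x ⟨hx.1, hx.2.le⟩] at this
      rw [add_zero, hψe x ⟨hx.1, hx.2.le⟩]
      exact mul_le_mul_of_nonneg_left this hK) t ht
  rw [gronwallBound_ε0] at key
  have := h t ht
  rw [hint t ht] at this
  exact this.trans key

/-- Global existence of Carathéodory solutions for right-hand sides that are uniformly Lipschitz
in the state and integrable along continuous curves. -/
theorem exists_caratheodory_solution {E : Type*} [NormedAddCommGroup E] [NormedSpace ℝ E]
    [CompleteSpace E] (F : ℝ → E → E) {a b α : ℝ} (hab : a ≤ b) (hα : 0 < α)
    (hlip : ∀ t ∈ Icc a b, ∀ x y, ‖F t x - F t y‖ ≤ α * ‖x - y‖)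
    (hint : ∀ x : ℝ → E, ContinuousOn x (Icc a b) →
      IntervalIntegrable (fun s => F s (x s)) volume a b) (x₀ : E) :
    ∃ x : ℝ → E, ContinuousOn x (Icc a b) ∧
      ∀ t ∈ Icc a b, x t = x₀ + ∫ s in a..t, F s (x s) := by
  -- Picard iteration in the variable `y t = exp (-2 α (t - a)) • x t`
  set e : ℝ → ℝ := fun t => Real.exp (2 * α * (t - a)) with he
  have hec : Continuous e := by fun_prop
  set X : C(Icc a b, E) → ℝ → E := fun y s => e s • IccExtend hab y s with hX
  have hXc : ∀ y, Continuous (X y) := fun y => hec.smul (y.continuous.Icc_extend')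
  have hXi : ∀ y, IntervalIntegrable (fun s => F s (X y s)) volume a b :=
    fun y => hint _ (hXc y).continuousOn
  have hXi' : ∀ y, ∀ t ∈ Icc a b, IntervalIntegrable (fun s => F s (X y s)) volume a t :=
    fun y t ht => (hXi y).mono_set (by
      rw [uIcc_of_le hab, uIcc_of_le ht.1]; exact Icc_subset_Icc_right ht.2)
  have hΦc : ∀ y, ContinuousOn (fun t => (e t)⁻¹ • (x₀ + ∫ s in a..t, F s (X y s))) (Icc a b) := by
    intro y
    refine ContinuousOn.smul (hec.continuousOn.inv₀ fun t _ => (Real.exp_pos _).ne') ?_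
    refine continuousOn_const.add ?_
    have := intervalIntegral.continuousOn_primitive_interval (μ := volume)
      (f := fun s => F s (X y s)) (a := a) (b := b)
      ((intervalIntegrable_iff_integrableOn_Icc_of_le hab).1 (hXi y) |>.mono_set
        (by rw [uIcc_of_le hab]))
    rwa [uIcc_of_le hab] at this
  have hΦc' : ∀ y, Continuous fun t : Icc a b => (e t)⁻¹ • (x₀ + ∫ s in a..(t : ℝ), F s (X y s)) :=
    fun y => continuousOn_iff_continuous_domRestrict.1 (hΦc y)
  set Φ : C(Icc a b, E) → C(Icc a b, E) := fun y => ⟨_, hΦc' y⟩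
  have hΦ : ∀ y t, Φ y t = (e t)⁻¹ • (x₀ + ∫ s in a..(t : ℝ), F s (X y s)) := fun _ _ => rfl
  -- The exponential rate `2α` gives `∫ α e ≤ e(t) / 2`, so dividing by the weight leaves the factor
  -- `1/2` whatever the length of the interval.
  have hcontr : ContractingWith (1 / 2) Φ := by
    refine ⟨by rw [← NNReal.coe_lt_coe]; norm_num, LipschitzWith.of_dist_le_mul fun y z => ?_⟩
    rw [ContinuousMap.dist_le (by positivity)]
    rintro ⟨t, ht⟩
    have hdiff : ‖∫ s in a..t, (F s (X y s) - F s (X z s))‖ ≤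
        ∫ s in a..t, α * dist y z * e s := by
      refine intervalIntegral.norm_integral_le_of_norm_le ht.1 ?_
        ((continuous_const.mul hec).intervalIntegrable _ _)
      refine Filter.Eventually.of_forall fun s hs => ?_
      have hs' : s ∈ Icc a b := ⟨hs.1.le, hs.2.trans ht.2⟩
      refine (hlip s hs' _ _).trans ?_
      rw [mul_assoc]
      refine mul_le_mul_of_nonneg_left ?_ hα.le
      simp only [hX]
      rw [← smul_sub, norm_smul, Real.norm_of_nonneg (Real.exp_pos _).le, mul_comm]
      refine mul_le_mul_of_nonneg_right ?_ (Real.exp_pos _).le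
      rw [IccExtend_of_mem hab _ hs', IccExtend_of_mem hab _ hs', ← dist_eq_norm]
      exact ContinuousMap.dist_apply_le_dist _
    have hval : ∫ s in a..t, α * dist y z * e s = dist y z / 2 * (e t - 1) := by
      have : ∀ s ∈ uIcc a t, HasDerivAt (fun s => dist y z / 2 * e s) (α * dist y z * e s) s := by
        intro s _
        have h1 : HasDerivAt (fun s : ℝ => 2 * α * (s - a)) (2 * α) s := by
          simpa using ((hasDerivAt_id s).sub_const a).const_mul (2 * α)
        have h2 : HasDerivAt e (e s * (2 * α)) s := h1.exp
        exact (h2.const_mul (dist y z / 2)).congr_deriv (by ring)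
      rw [intervalIntegral.integral_eq_sub_of_hasDerivAt this
        ((continuous_const.mul hec).intervalIntegrable _ _)]
      simp [he]; ring
    rw [hval] at hdiff
    have hpos : 0 < e t := Real.exp_pos _
    rw [dist_eq_norm]
    rw [hΦ, hΦ, ← smul_sub, add_sub_add_left_eq_sub,
      ← intervalIntegral.integral_sub (hXi' y t ht) (hXi' z t ht), norm_smul, norm_inv,
      Real.norm_of_nonneg hpos.le, inv_mul_le_iff₀ hpos]
    refine hdiff.trans ?_
    have : (0 : ℝ) ≤ dist y z := dist_nonneg
    push_cast
    nlinarith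
  obtain ⟨y, hy, -⟩ := hcontr.exists_fixedPoint 0 (edist_ne_top _ _)
  refine ⟨X y, (hXc y).continuousOn, fun t ht => ?_⟩
  have h1 : y ⟨t, ht⟩ = (e t)⁻¹ • (x₀ + ∫ s in a..t, F s (X y s)) :=
    (DFunLike.congr_fun hy ⟨t, ht⟩).symm
  have h2 : X y t = e t • y ⟨t, ht⟩ := by simp only [hX]; rw [IccExtend_of_mem hab _ ht]
  rw [h2, h1, smul_smul, mul_inv_cancel₀ (Real.exp_pos _).ne', one_smul]

/-! ### Lipschitz functions and `W^{1,∞}`. -/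

section Sobolev

variable {n : ℕ} {Ω : Set (Vec n × ℝ)} {w : Vec n × ℝ → ℝ} {e : Vec n × ℝ}

instance : (volume : Measure (Vec n × ℝ)).IsAddHaarMeasure :=
  inferInstanceAs ((volume : Measure (Vec n)).prod (volume : Measure ℝ)).IsAddHaarMeasure

theorem integrable_mul_of_locallyIntegrableOn {v φ : Vec n × ℝ → ℝ}
    (hv : LocallyIntegrableOn v (interior Ω)) (hφ : Continuous φ) (hc : HasCompactSupport φ)
    (hs : tsupport φ ⊆ interior Ω) : Integrable (fun z => v z * φ z) := by
  have h1 : IntegrableOn v (tsupport φ) := hv.integrableOn_compact_subset hs hc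
  have h2 : IntegrableOn (fun z => v z * φ z) (tsupport φ) := h1.mul_continuousOn hφ.continuousOn hc
  refine (integrableOn_iff_integrable_of_support_subset fun z hz => ?_).1 h2
  exact subset_tsupport _ (right_ne_zero_of_mul hz)

/-- Uniqueness of weak derivatives. -/
theorem HasWeakDeriv.ae_eq {v v' : Vec n × ℝ → ℝ} (h : HasWeakDeriv Ω w e v)
    (h' : HasWeakDeriv Ω w e v') : v =ᵐ[volume.restrict (interior Ω)] v' := by
  have key : ∀ᵐ z ∂(volume : Measure (Vec n × ℝ)), z ∈ interior Ω → (v - v') z = 0 := by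
    refine isOpen_interior.ae_eq_zero_of_integral_contDiff_smul_eq_zero (h.2.1.sub h'.2.1)
      fun φ hφ hc hs => ?_
    have hz : ∀ u : Vec n × ℝ → ℝ, ∫ z in Ω, u z * φ z = ∫ z, u z * φ z := fun u =>
      setIntegral_eq_integral_of_forall_compl_eq_zero fun z hz => by
        rw [image_eq_zero_of_notMem_tsupport fun h => hz (interior_subset (hs h)), mul_zero]
    have e1 := h.2.2 φ hφ hc hs
    have e2 := h'.2.2 φ hφ hc hs
    rw [hz] at e1 e2
    have : ∫ z, φ z • (v - v') z = (∫ z, v z * φ z) - ∫ z, v' z * φ z := by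
      rw [← integral_sub (integrable_mul_of_locallyIntegrableOn h.2.1 hφ.continuous hc hs)
        (integrable_mul_of_locallyIntegrableOn h'.2.1 hφ.continuous hc hs)]
      refine integral_congr_ae (Filter.Eventually.of_forall fun z => ?_)
      simp only [Pi.sub_apply, smul_eq_mul]
      ring
    rw [this]
    linarith
  refine (ae_restrict_iff' isOpen_interior.measurableSet).2 ?_
  filter_upwards [key] with z hz hzΩ
  exact sub_eq_zero.1 (hz hzΩ)

/-- A function that agrees with a Lipschitz function on the interior of `Ω` has weak derivatives
on `Ω`, given by the line derivatives of the latter. -/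
theorem LipschitzWith.hasWeakDeriv {K : NNReal} {w' : Vec n × ℝ → ℝ} (hw' : LipschitzWith K w')
    (hww' : EqOn w w' (interior Ω)) (e : Vec n × ℝ) :
    HasWeakDeriv Ω w e (fun z => lineDeriv ℝ w' z e) := by
  refine ⟨?_, (hw'.locallyIntegrable_lineDeriv e).locallyIntegrableOn _, fun φ hφ hc hs => ?_⟩
  · refine (hw'.continuous.locallyIntegrable.locallyIntegrableOn _).congr ?_
    exact (ae_restrict_iff' isOpen_interior.measurableSet).2
      (Filter.Eventually.of_forall fun z hz => (hww' hz).symm)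
  · obtain ⟨D, hD⟩ := ContDiff.lipschitzWith_of_hasCompactSupport hc
      (hφ.of_le (n := (⊤ : ℕ∞)) (m := 1) (by exact_mod_cast le_top)) (by simp)
    -- Since `φ` and its derivative vanish off the interior, both integrals extend to the whole
    -- space with `w'` in place of `w`, where integration by parts for Lipschitz functions applies.
    have hoff : ∀ z, z ∉ interior Ω → φ z = 0 ∧ fderiv ℝ φ z e = 0 := fun z hz => by
      refine ⟨image_eq_zero_of_notMem_tsupport fun h => hz (hs h), ?_⟩
      rw [image_eq_zero_of_notMem_tsupport (f := fderiv ℝ φ)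
        fun h => hz (hs (tsupport_fderiv_subset ℝ h))]
      rfl
    have e1 : ∫ z in Ω, w z * fderiv ℝ φ z e = ∫ z, w' z * fderiv ℝ φ z e := by
      rw [setIntegral_eq_integral_of_forall_compl_eq_zero fun z hz => by
        rw [(hoff z fun h => hz (interior_subset h)).2, mul_zero]]
      congr 1
      ext z
      by_cases hz : z ∈ interior Ω
      · rw [hww' hz]
      · rw [(hoff z hz).2, mul_zero, mul_zero]
    have e2 : ∫ z in Ω, lineDeriv ℝ w' z e * φ z = ∫ z, lineDeriv ℝ w' z e * φ z :=
      setIntegral_eq_integral_of_forall_compl_eq_zero fun z hz => by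
        rw [(hoff z fun h => hz (interior_subset h)).1, mul_zero]
    rw [e1, e2, LipschitzWith.integral_lineDeriv_mul_eq hw' hD hc e, ← integral_neg]
    congr 1
    ext z
    rw [((hφ.differentiable (by simp)) z).lineDeriv_eq_fderiv]
    simp [mul_comm]

/-- `weakDeriv` is an arbitrary choice. Uniqueness lets the norm be evaluated on any known weak
derivative. -/
theorem weakDeriv_ae_eq {v : Vec n × ℝ → ℝ} (h : HasWeakDeriv Ω w e v) :
    weakDeriv Ω w e =ᵐ[volume.restrict (interior Ω)] v := by
  have hex : ∃ v, HasWeakDeriv Ω w e v := ⟨v, h⟩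
  rw [weakDeriv, dif_pos hex]
  exact (Classical.choose_spec hex).ae_eq h

theorem MeasureTheory.MemLp.ae_abs_le_toReal_eLpNorm_top {α : Type*} [MeasurableSpace α]
    {μ : Measure α} {v : α → ℝ} (h : MemLp v ⊤ μ) :
    ∀ᵐ z ∂μ, |v z| ≤ (eLpNorm v ⊤ μ).toReal := by
  rw [eLpNorm_exponent_top]
  filter_upwards [ae_le_eLpNormEssSup (f := v) (μ := μ)] with z hz
  have hfin : eLpNormEssSup v μ ≠ ⊤ := by
    have := h.2.ne
    rwa [eLpNorm_exponent_top] at this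
  rw [← Real.norm_eq_abs, ← toReal_enorm]
  exact ENNReal.toReal_mono hfin hz

/-- A Lipschitz function on a bounded set with negligible boundary is in `W^{1,∞}`. It is
differentiable almost everywhere, and the `W^{1,∞}`-norm splits into bounds for its values, its
spatial derivatives and its time derivative. -/
theorem LipschitzOnWith.memW1Inf {K : NNReal} (hw : LipschitzOnWith K w Ω)
    (hb : Bornology.IsBounded Ω) (hΩ : Ω =ᵐ[volume] interior Ω) :
    MemW1Inf Ω w ∧ ∃ N₀ S N₁ : ℝ, 0 ≤ N₀ ∧ 0 ≤ S ∧ 0 ≤ N₁ ∧ w1InfNorm Ω w = N₀ + S + N₁ ∧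
      ∀ᵐ z ∂volume.restrict (interior Ω), DifferentiableAt ℝ w z ∧ |w z| ≤ N₀ ∧
        (∀ v : Vec n, |fderiv ℝ w z (v, 0)| ≤ ‖v‖ * S) ∧ |fderiv ℝ w z (0, 1)| ≤ N₁ := by
  -- A global Lipschitz extension gives access to Rademacher's theorem and to line derivatives on
  -- the whole space.
  obtain ⟨w', hw', hww'⟩ := hw.extend_real
  have hres : (volume.restrict Ω : Measure (Vec n × ℝ)) = volume.restrict (interior Ω) :=
    Measure.restrict_congr_set hΩ
  have hwd := fun e => hw'.hasWeakDeriv (hww'.mono interior_subset) e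
  have hmem : ∀ e, MemLp (fun z => lineDeriv ℝ w' z e) ⊤ (volume.restrict Ω) :=
    fun e => (hw'.memLp_lineDeriv e).restrict Ω
  have hw0 : MemLp w ⊤ (volume.restrict Ω) := by
    obtain ⟨B, hB⟩ := (hw'.isBounded_image hb).exists_norm_le
    have hae : ∀ᵐ z ∂volume.restrict Ω, z ∈ Ω := by
      rw [hres]
      filter_upwards [ae_restrict_mem isOpen_interior.measurableSet] with z hz
      exact interior_subset hz
    refine memLp_top_of_bound (hw'.continuous.aestronglyMeasurable.congr ?_) B ?_
    · filter_upwards [hae] with z hz using (hww' hz).symm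
    · filter_upwards [hae] with z hz using hww' hz ▸ hB _ (mem_image_of_mem _ hz)
  refine ⟨⟨hw0, fun i => ⟨_, hwd _, hmem _⟩, _, hwd _, hmem _⟩, _, _, _, ENNReal.toReal_nonneg,
    Finset.sum_nonneg fun i _ => ENNReal.toReal_nonneg, ENNReal.toReal_nonneg, rfl, ?_⟩
  have hae : ∀ e, ∀ᵐ z ∂volume.restrict (interior Ω), |lineDeriv ℝ w' z e| ≤
      (eLpNorm (weakDeriv Ω w e) ⊤ (volume.restrict Ω)).toReal := fun e => by
    have h1 := weakDeriv_ae_eq (hwd e)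
    have h2 := (hmem e).ae_abs_le_toReal_eLpNorm_top
    rw [← hres] at h1 ⊢
    rwa [eLpNorm_congr_ae h1]
  have h0 := hw0.ae_abs_le_toReal_eLpNorm_top
  rw [hres] at h0
  have hS : ∀ᵐ z ∂volume.restrict (interior Ω), ∀ i : Fin n,
      |lineDeriv ℝ w' z (spaceDir i)| ≤
        (eLpNorm (weakDeriv Ω w (spaceDir i)) ⊤ (volume.restrict Ω)).toReal :=
    ae_all_iff.2 fun i => hae _
  filter_upwards [h0, hS, hae (timeDir n), ae_restrict_mem isOpen_interior.measurableSet,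
    ae_restrict_of_ae (hw'.ae_differentiableAt (μ := volume))] with z z0 zS zt hz zd
  have hnhds : w =ᶠ[nhds z] w' :=
    Filter.eventuallyEq_of_mem (isOpen_interior.mem_nhds hz) (hww'.mono interior_subset)
  have hfd : fderiv ℝ w z = fderiv ℝ w' z := hnhds.fderiv_eq
  refine ⟨zd.congr_of_eventuallyEq hnhds, by rwa [hres], fun v => ?_, ?_⟩
  -- Expanding in coordinates, `|vᵢ| ≤ ‖v‖` shows that the sum of the partial bounds controls every
  -- spatial direction.
  · have hv : (v, (0 : ℝ)) = ∑ i, v i • (spaceDir i : Vec n × ℝ) := by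
      refine Prod.ext ?_ ?_
      · rw [Prod.fst_sum]
        ext j
        simp [spaceDir, Pi.single_apply]
      · rw [Prod.snd_sum]
        simp [spaceDir]
    rw [hfd, hv, map_sum, Finset.mul_sum]
    refine (Finset.abs_sum_le_sum_abs _ _).trans (Finset.sum_le_sum fun i _ => ?_)
    rw [map_smul, smul_eq_mul, abs_mul, ← zd.lineDeriv_eq_fderiv]
    refine mul_le_mul ?_ (zS i) (abs_nonneg _) (norm_nonneg _)
    exact PiLp.norm_apply_le v i
  · rw [hfd, ← zd.lineDeriv_eq_fderiv]
    exact zt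

end Sobolev

/-! ### Admissible trajectories and their bounds. -/

namespace OCP

variable {n m : ℕ} {P : OCP n m} {βf : ℝ}

/-- Continuity of `h` is known only on a closed set. The pushforward measure under `s ↦ (s, x s, u
s)` is concentrated there, which gives measurability; linear growth along a bounded curve gives
integrability. -/
theorem intervalIntegrable_comp (hU : IsCompact P.U) {F : Type*} [NormedAddCommGroup F]
    {h : ℝ → Vec n → Vec m → F}
    (hh : ContinuousOn (fun p : ℝ × Vec n × Vec m => h p.1 p.2.1 p.2.2)
      (Icc 0 P.T ×ˢ (univ ×ˢ P.U)))
    {β : ℝ} (hβ : 0 < β) (hgr : ∀ t ∈ Icc 0 P.T, ∀ u ∈ P.U, ∀ x : Vec n, ‖h t x u‖ ≤ β * (1 + ‖x‖))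
    {t₀ : ℝ} (ht₀ : t₀ ∈ Icc 0 P.T) {u : ℝ → Vec m} {x : ℝ → Vec n}
    (hu : AEMeasurable u (volume.restrict (Icc t₀ P.T))) (hmem : ∀ t ∈ Icc t₀ P.T, u t ∈ P.U)
    (hx : ContinuousOn x (Icc t₀ P.T)) :
    IntervalIntegrable (fun s => h s (x s) (u s)) volume t₀ P.T := by
  have hS : MeasurableSet (Icc 0 P.T ×ˢ (univ ×ˢ P.U) : Set (ℝ × Vec n × Vec m)) :=
    measurableSet_Icc.prod (MeasurableSet.univ.prod hU.measurableSet)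
  have hpair : AEMeasurable (fun s => (s, x s, u s)) (volume.restrict (Icc t₀ P.T)) :=
    aemeasurable_id.prodMk ((hx.aemeasurable measurableSet_Icc).prodMk hu)
  have hin : ∀ s ∈ Icc t₀ P.T, (s, x s, u s) ∈ Icc 0 P.T ×ˢ (univ ×ˢ P.U) :=
    fun s hs => ⟨⟨ht₀.1.trans hs.1, hs.2⟩, mem_univ _, hmem s hs⟩
  have hmap : ∀ᵐ p ∂(volume.restrict (Icc t₀ P.T)).map (fun s => (s, x s, u s)),
      p ∈ Icc 0 P.T ×ˢ (univ ×ˢ P.U) := by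
    refine (ae_map_iff hpair hS).2 ?_
    filter_upwards [ae_restrict_mem measurableSet_Icc] with s hs using hin s hs
  have hmeas : AEStronglyMeasurable (fun s => h s (x s) (u s))
      (volume.restrict (Icc t₀ P.T)) := by
    refine AEStronglyMeasurable.comp_aemeasurable (g := fun p : ℝ × Vec n × Vec m =>
      h p.1 p.2.1 p.2.2) ?_ hpair
    rw [← Measure.restrict_eq_self_of_ae_mem hmap]
    exact hh.aestronglyMeasurable hS
  obtain ⟨B, hB⟩ := isCompact_Icc.exists_bound_of_continuousOn hx
  rw [intervalIntegrable_iff_integrableOn_Icc_of_le ht₀.2]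
  refine Integrable.of_bound hmeas (β * (1 + B)) ?_
  filter_upwards [ae_restrict_mem measurableSet_Icc] with s hs
  refine (hgr s ⟨ht₀.1.trans hs.1, hs.2⟩ _ (hmem s hs) _).trans ?_
  exact mul_le_mul_of_nonneg_left (by linarith [hB s hs]) hβ.le

theorem _root_.IntervalIntegrable.mono_Icc {F : Type*} [NormedAddCommGroup F] {g : ℝ → F}
    {a b s t : ℝ} (h : IntervalIntegrable g volume a b) (hs : s ∈ Icc a b) (ht : t ∈ Icc a b) :
    IntervalIntegrable g volume s t :=
  h.mono_set (uIcc_subset_uIcc (Icc_subset_uIcc hs) (Icc_subset_uIcc ht))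

theorem exists_admissible (hP : P.IsClassL βf) {t₀ : ℝ} (ht₀ : t₀ ∈ Icc 0 P.T) {u : ℝ → Vec m}
    (hu : AEMeasurable u (volume.restrict (Icc t₀ P.T))) (hmem : ∀ t ∈ Icc t₀ P.T, u t ∈ P.U)
    (x₀ : Vec n) : ∃ x, P.Admissible x₀ t₀ u x := by
  obtain ⟨α, hα, hlip⟩ := hP.f_lip
  have hint : ∀ x : ℝ → Vec n, ContinuousOn x (Icc t₀ P.T) →
      IntervalIntegrable (fun s => P.f s (x s) (u s)) volume t₀ P.T := fun x hx =>
    intervalIntegrable_comp hP.U_compact hP.f_cont hP.βf_pos hP.f_growth ht₀ hu hmem hx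
  obtain ⟨x, hx, hxe⟩ := exists_caratheodory_solution (fun t x => P.f t x (u t)) ht₀.2 hα
    (fun t ht x y => hlip t ⟨ht₀.1.trans ht.1, ht.2⟩ _ (hmem t ht) x y) hint x₀
  exact ⟨x, hu, hmem, hx, hint x hx, hxe⟩

namespace Admissible

variable {x₀ : Vec n} {t₀ : ℝ} {u : ℝ → Vec m} {x : ℝ → Vec n}

theorem apply_left (h : P.Admissible x₀ t₀ u x) (ht₀ : t₀ ≤ P.T) : x t₀ = x₀ := by
  simpa using h.eq t₀ ⟨le_rfl, ht₀⟩

theorem sub_eq (h : P.Admissible x₀ t₀ u x) {s t : ℝ} (hs : s ∈ Icc t₀ P.T)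
    (ht : t ∈ Icc t₀ P.T) : x t - x s = ∫ r in s..t, P.f r (x r) (u r) := by
  have h0 : t₀ ∈ Icc t₀ P.T := ⟨le_rfl, hs.1.trans hs.2⟩
  rw [h.eq s hs, h.eq t ht, add_sub_add_left_eq_sub, intervalIntegral.integral_interval_sub_left
    (h.integrable.mono_Icc h0 ht) (h.integrable.mono_Icc h0 hs)]

theorem restrict (h : P.Admissible x₀ t₀ u x) {t₁ : ℝ} (ht₁ : t₁ ∈ Icc t₀ P.T) :
    P.Admissible (x t₁) t₁ u x where
  measurable := h.measurable.mono_measure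
    (Measure.restrict_mono (Icc_subset_Icc_left ht₁.1) le_rfl)
  mem t ht := h.mem t ⟨ht₁.1.trans ht.1, ht.2⟩
  continuous := h.continuous.mono (Icc_subset_Icc_left ht₁.1)
  integrable := h.integrable.mono_Icc ht₁ ⟨ht₁.1.trans ht₁.2, le_rfl⟩
  eq t ht := by
    rw [← h.sub_eq ht₁ ⟨ht₁.1.trans ht.1, ht.2⟩]
    abel

theorem intervalIntegrable_cost (h : P.Admissible x₀ t₀ u x) (hP : P.IsClassL βf)
    (ht₀ : t₀ ∈ Icc 0 P.T) :
    IntervalIntegrable (fun s => P.c s (x s) (u s)) volume t₀ P.T := by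
  obtain ⟨β, hβ, hc⟩ := hP.c_growth
  exact intervalIntegrable_comp hP.U_compact hP.c_cont hβ hc ht₀ h.measurable h.mem h.continuous

theorem cost_eq_add (h : P.Admissible x₀ t₀ u x) (hP : P.IsClassL βf)
    (ht₀ : t₀ ∈ Icc 0 P.T) {t₁ : ℝ} (ht₁ : t₁ ∈ Icc t₀ P.T) :
    P.cost t₀ u x = (∫ t in t₀..t₁, P.c t (x t) (u t)) + P.cost t₁ u x := by
  have hi := h.intervalIntegrable_cost hP ht₀
  rw [cost, cost, ← add_assoc, intervalIntegral.integral_add_adjacent_intervals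
    (hi.mono_Icc ⟨le_rfl, ht₀.2⟩ ht₁) (hi.mono_Icc ht₁ ⟨ht₀.2, le_rfl⟩)]

theorem one_add_norm_le_exp (h : P.Admissible x₀ t₀ u x) (hP : P.IsClassL βf) (ht₀ : 0 ≤ t₀)
    {t : ℝ} (ht : t ∈ Icc t₀ P.T) :
    1 + ‖x t‖ ≤ (1 + ‖x₀‖) * Real.exp (βf * (t - t₀)) := by
  have hcont : ContinuousOn (fun t => 1 + ‖x t‖) (Icc t₀ P.T) :=
    continuousOn_const.add h.continuous.norm
  refine le_mul_exp_of_le_add_integral hP.βf_pos.le hcont (fun t ht => ?_) t ht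
  have hint : IntervalIntegrable (fun s => βf * (1 + ‖x s‖)) volume t₀ t :=
    (continuousOn_const.mul (hcont.mono (by
      rw [uIcc_of_le ht.1]; exact Icc_subset_Icc_right ht.2))).intervalIntegrable
  have := intervalIntegral.norm_integral_le_of_norm_le ht.1 (Filter.Eventually.of_forall
    fun s (hs : s ∈ Ioc t₀ t) => hP.f_growth s ⟨ht₀.trans hs.1.le, hs.2.trans ht.2⟩ (u s)
      (h.mem s ⟨hs.1.le, hs.2.trans ht.2⟩) (x s)) hint
  rw [intervalIntegral.integral_const_mul] at this
  rw [h.eq t ht]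
  linarith [norm_add_le x₀ (∫ s in t₀..t, P.f s (x s) (u s))]

/-- For `t₀ = 0` this is the origin of `R`: the trajectory stays in the closed ball of radius `R`.
-/
theorem one_add_norm_le (h : P.Admissible x₀ t₀ u x) (hP : P.IsClassL βf) (ht₀ : 0 ≤ t₀)
    {t : ℝ} (ht : t ∈ Icc t₀ P.T) : 1 + ‖x t‖ ≤ (1 + ‖x₀‖) * Real.exp (βf * P.T) := by
  refine (h.one_add_norm_le_exp hP ht₀ ht).trans ?_
  have := hP.βf_pos
  gcongr
  linarith [ht.2]

theorem norm_f_le (h : P.Admissible x₀ t₀ u x) (hP : P.IsClassL βf) (ht₀ : 0 ≤ t₀)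
    {t : ℝ} (ht : t ∈ Icc t₀ P.T) :
    ‖P.f t (x t) (u t)‖ ≤ βf * ((1 + ‖x₀‖) * Real.exp (βf * P.T)) :=
  (hP.f_growth t ⟨ht₀.trans ht.1, ht.2⟩ _ (h.mem t ht) _).trans
    (mul_le_mul_of_nonneg_left (h.one_add_norm_le hP ht₀ ht) hP.βf_pos.le)

theorem norm_sub_le (h : P.Admissible x₀ t₀ u x) (hP : P.IsClassL βf) (ht₀ : 0 ≤ t₀)
    {s t : ℝ} (hs : s ∈ Icc t₀ P.T) (ht : t ∈ Icc t₀ P.T) :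
    ‖x t - x s‖ ≤ βf * ((1 + ‖x₀‖) * Real.exp (βf * P.T)) * |t - s| := by
  rw [h.sub_eq hs ht]
  refine intervalIntegral.norm_integral_le_of_norm_le_const fun r hr => h.norm_f_le hP ht₀ ?_
  exact uIcc_subset_Icc hs ht (uIoc_subset_uIcc hr)

end Admissible

/-! ### Regularity of the value function. -/

/-- The cost depends in a Lipschitz way on the initial state, for a fixed input. -/
theorem exists_cost_lipschitz (hP : P.IsClassL βf) : ∃ K : ℝ, 0 ≤ K ∧
    ∀ t₀ ∈ Icc 0 P.T, ∀ (x₀ y₀ : Vec n) (u : ℝ → Vec m) (x y : ℝ → Vec n),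
      P.Admissible x₀ t₀ u x → P.Admissible y₀ t₀ u y →
        P.cost t₀ u x ≤ P.cost t₀ u y + K * ‖x₀ - y₀‖ := by
  obtain ⟨αf, hαf, hf⟩ := hP.f_lip
  obtain ⟨αc, hαc, hc⟩ := hP.c_lip
  obtain ⟨αg, hαg, hg⟩ := hP.g_lip
  have hT := hP.T_pos
  refine ⟨(αc * P.T + αg) * Real.exp (αf * P.T), by positivity, ?_⟩
  intro t₀ ht₀ x₀ y₀ u x y hx hy
  have hcont : ContinuousOn (fun t => ‖x t - y t‖) (Icc t₀ P.T) :=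
    (hx.continuous.sub hy.continuous).norm
  have hdist : ∀ t ∈ Icc t₀ P.T, ‖x t - y t‖ ≤ ‖x₀ - y₀‖ * Real.exp (αf * P.T) := by
    intro t ht
    refine (le_mul_exp_of_le_add_integral (δ := ‖x₀ - y₀‖) hαf.le hcont (fun t ht => ?_) t
      ht).trans ?_
    · have hint : IntervalIntegrable (fun s => αf * ‖x s - y s‖) volume t₀ t :=
        (continuousOn_const.mul (hcont.mono (by
          rw [uIcc_of_le ht.1]; exact Icc_subset_Icc_right ht.2))).intervalIntegrable
      have := intervalIntegral.norm_integral_le_of_norm_le ht.1 (Filter.Eventually.of_forall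
        fun s (hs : s ∈ Ioc t₀ t) => hf s ⟨ht₀.1.trans hs.1.le, hs.2.trans ht.2⟩ (u s)
          (hx.mem s ⟨hs.1.le, hs.2.trans ht.2⟩) (x s) (y s)) hint
      rw [intervalIntegral.integral_const_mul, intervalIntegral.integral_sub
        (hx.integrable.mono_Icc ⟨le_rfl, ht₀.2⟩ ht) (hy.integrable.mono_Icc ⟨le_rfl, ht₀.2⟩ ht)]
        at this
      rw [hx.eq t ht, hy.eq t ht, add_sub_add_comm]
      exact (norm_add_le _ _).trans (add_le_add_right this _)
    · gcongr
      linarith [ht.2, ht₀.1]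
  have hi := hx.intervalIntegrable_cost hP ht₀
  have hi' := hy.intervalIntegrable_cost hP ht₀
  have h1 : (∫ t in t₀..P.T, P.c t (x t) (u t)) - (∫ t in t₀..P.T, P.c t (y t) (u t)) ≤
      αc * (‖x₀ - y₀‖ * Real.exp (αf * P.T)) * P.T := by
    rw [← intervalIntegral.integral_sub hi hi']
    refine (le_abs_self _).trans ?_
    rw [← Real.norm_eq_abs]
    refine (intervalIntegral.norm_integral_le_of_norm_le_const
      (C := αc * (‖x₀ - y₀‖ * Real.exp (αf * P.T))) fun s hs => ?_).trans ?_
    · rw [uIoc_of_le ht₀.2] at hs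
      have hs' : s ∈ Icc t₀ P.T := ⟨hs.1.le, hs.2⟩
      exact (hc s ⟨ht₀.1.trans hs'.1, hs'.2⟩ _ (hx.mem s hs') _ _).trans
        (mul_le_mul_of_nonneg_left (hdist s hs') hαc.le)
    · rw [abs_of_nonneg (by linarith [ht₀.2])]
      exact mul_le_mul_of_nonneg_left (by linarith [ht₀.1]) (by positivity)
  have h2 : P.g (x P.T) - P.g (y P.T) ≤ αg * (‖x₀ - y₀‖ * Real.exp (αf * P.T)) :=
    (le_abs_self _).trans ((hg _ _).trans
      (mul_le_mul_of_nonneg_left (hdist _ ⟨ht₀.2, le_rfl⟩) hαg.le))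
  rw [cost, cost]
  nlinarith

/-- Ensures that the `sInf` defining the value function is a true infimum and not the default value
of a set unbounded below. -/
theorem bddBelow_cost (hP : P.IsClassL βf) {z : Vec n × ℝ} (hz : z.2 ∈ Icc 0 P.T) :
    BddBelow {r : ℝ | ∃ u x, P.Admissible z.1 z.2 u x ∧ r = P.cost z.2 u x} := by
  obtain ⟨βc, hβc, hc⟩ := hP.c_growth
  obtain ⟨βg, hβg, hg⟩ := hP.g_growth
  set B := (1 + ‖z.1‖) * Real.exp (βf * P.T)
  refine ⟨-(βc * B * |P.T - z.2|) - βg * B, ?_⟩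
  rintro r ⟨u, x, h, rfl⟩
  have h1 : ‖∫ t in z.2..P.T, P.c t (x t) (u t)‖ ≤ βc * B * |P.T - z.2| := by
    refine intervalIntegral.norm_integral_le_of_norm_le_const fun s hs => ?_
    rw [uIoc_of_le hz.2] at hs
    have hs' : s ∈ Icc z.2 P.T := ⟨hs.1.le, hs.2⟩
    exact (hc s ⟨hz.1.trans hs'.1, hs'.2⟩ _ (h.mem s hs') _).trans
      (mul_le_mul_of_nonneg_left (h.one_add_norm_le hP hz.1 hs') hβc.le)
  have h2 : |P.g (x P.T)| ≤ βg * B := (hg _).trans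
    (mul_le_mul_of_nonneg_left (h.one_add_norm_le hP hz.1 ⟨hz.2, le_rfl⟩) hβg.le)
  rw [Real.norm_eq_abs] at h1
  rw [cost]
  linarith [neg_abs_le (∫ t in z.2..P.T, P.c t (x t) (u t)), neg_abs_le (P.g (x P.T))]

theorem Admissible.valueFunction_le {x₀ : Vec n} {t₀ : ℝ} {u : ℝ → Vec m} {x : ℝ → Vec n}
    (h : P.Admissible x₀ t₀ u x) (hP : P.IsClassL βf) (ht₀ : t₀ ∈ Icc 0 P.T) :
    P.valueFunction (x₀, t₀) ≤ P.cost t₀ u x :=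
  csInf_le (bddBelow_cost (z := (x₀, t₀)) hP ht₀) ⟨u, x, h, rfl⟩

theorem le_valueFunction (hP : P.IsClassL βf) (hU : P.U.Nonempty) {t₀ : ℝ} (ht₀ : t₀ ∈ Icc 0 P.T)
    {x₀ : Vec n} {r : ℝ} (h : ∀ u x, P.Admissible x₀ t₀ u x → r ≤ P.cost t₀ u x) :
    r ≤ P.valueFunction (x₀, t₀) := by
  refine le_csInf ?_ ?_
  · obtain ⟨v, hv⟩ := hU
    obtain ⟨x, hx⟩ := exists_admissible hP ht₀ (u := fun _ => v) aemeasurable_const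
      (fun _ _ => hv) x₀
    exact ⟨_, _, x, hx, rfl⟩
  · rintro r ⟨u, x, hx, rfl⟩
    exact h u x hx

theorem valueFunction_terminal (hP : P.IsClassL βf) (hU : P.U.Nonempty) (x₀ : Vec n) :
    P.valueFunction (x₀, P.T) = P.g x₀ := by
  have hT : P.T ∈ Icc 0 P.T := ⟨hP.T_pos.le, le_rfl⟩
  have hcost : ∀ u x, P.Admissible x₀ P.T u x → P.cost P.T u x = P.g x₀ := fun u x h => by
    rw [cost, intervalIntegral.integral_same, zero_add, h.apply_left le_rfl]
  refine le_antisymm ?_ (le_valueFunction hP hU hT fun u x h => (hcost u x h).ge)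
  obtain ⟨v, hv⟩ := hU
  obtain ⟨x, hx⟩ := exists_admissible hP hT (u := fun _ => v) aemeasurable_const
    (fun _ _ => hv) x₀
  exact hcost _ x hx ▸ hx.valueFunction_le hP hT

/-- One half of the dynamic programming principle. -/
theorem Admissible.valueFunction_add_le_cost {x₀ : Vec n} {t₀ : ℝ} {u : ℝ → Vec m} {x : ℝ → Vec n}
    (h : P.Admissible x₀ t₀ u x) (hP : P.IsClassL βf) (ht₀ : t₀ ∈ Icc 0 P.T) {t₁ : ℝ}
    (ht₁ : t₁ ∈ Icc t₀ P.T) :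
    (∫ t in t₀..t₁, P.c t (x t) (u t)) + P.valueFunction (x t₁, t₁) ≤ P.cost t₀ u x := by
  rw [h.cost_eq_add hP ht₀ ht₁]
  exact add_le_add_right ((h.restrict ht₁).valueFunction_le hP ⟨ht₀.1.trans ht₁.1, ht₁.2⟩) _

/-- Any input used from `y` may be used from `x` as well, and the costs differ by at most `K * ‖x -
y‖`. -/
theorem exists_valueFunction_lipschitz_space (hP : P.IsClassL βf) (hU : P.U.Nonempty) :
    ∃ K : ℝ, 0 ≤ K ∧ ∀ t ∈ Icc 0 P.T, ∀ x y : Vec n,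
      P.valueFunction (x, t) ≤ P.valueFunction (y, t) + K * ‖x - y‖ := by
  obtain ⟨K, hK, hcost⟩ := exists_cost_lipschitz hP
  refine ⟨K, hK, fun t ht x₀ y₀ => ?_⟩
  rw [← sub_le_iff_le_add]
  refine le_valueFunction hP hU ht fun u y hy => ?_
  obtain ⟨x, hx⟩ := exists_admissible hP ht hy.measurable hy.mem x₀
  linarith [hx.valueFunction_le hP ht, hcost t ht x₀ y₀ u x y hx hy]

/-- During `[s, t]` a trajectory accumulates cost at most `βc B (t - s)` in absolute value and moves
at most `βf B (t - s)`. The displacement is converted into cost by the spatial Lipschitz constants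
`K` and `K'`, one for each direction of the inequality. -/
theorem exists_valueFunction_lipschitz_time (hP : P.IsClassL βf) (hU : P.U.Nonempty) (ρ : ℝ) :
    ∃ K : ℝ, 0 ≤ K ∧ ∀ s ∈ Icc 0 P.T, ∀ t ∈ Icc s P.T, ∀ x : Vec n, ‖x‖ ≤ ρ →
      |P.valueFunction (x, s) - P.valueFunction (x, t)| ≤ K * (t - s) := by
  obtain ⟨K, hK, hcost⟩ := exists_cost_lipschitz hP
  obtain ⟨K', hK', hV⟩ := exists_valueFunction_lipschitz_space hP hU
  obtain ⟨βc, hβc, hc⟩ := hP.c_growth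
  have hβf := hP.βf_pos
  set B := (1 + |ρ|) * Real.exp (βf * P.T) with hB
  have hBpos : 0 < B := by positivity
  refine ⟨βc * B + (K + K') * (βf * B), by positivity, fun s hs t ht x₀ hx₀ => ?_⟩
  have htT : t ∈ Icc 0 P.T := ⟨hs.1.trans ht.1, ht.2⟩
  have hts : 0 ≤ t - s := sub_nonneg.2 ht.1
  have hsT : s ∈ Icc s P.T := ⟨le_rfl, hs.2⟩
  have hBx : (1 + ‖x₀‖) * Real.exp (βf * P.T) ≤ B := by
    rw [hB]
    gcongr
    exact hx₀.trans (le_abs_self ρ)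
  have hint : ∀ u x, P.Admissible x₀ s u x →
      |∫ r in s..t, P.c r (x r) (u r)| ≤ βc * B * (t - s) := fun u x h => by
    rw [← Real.norm_eq_abs, ← abs_of_nonneg hts]
    refine intervalIntegral.norm_integral_le_of_norm_le_const fun r hr => ?_
    rw [uIoc_of_le ht.1] at hr
    have hr' : r ∈ Icc s P.T := ⟨hr.1.le, hr.2.trans ht.2⟩
    exact (hc r ⟨hs.1.trans hr'.1, hr'.2⟩ _ (h.mem r hr') _).trans
      (mul_le_mul_of_nonneg_left ((h.one_add_norm_le hP hs.1 hr').trans hBx) hβc.le)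
  have hmove : ∀ u x, P.Admissible x₀ s u x → ‖x t - x₀‖ ≤ βf * B * (t - s) := fun u x h => by
    have := h.norm_sub_le hP hs.1 hsT ht
    rw [h.apply_left hs.2, abs_of_nonneg hts] at this
    exact this.trans (by gcongr)
  have hKB : 0 ≤ K * (βf * B * (t - s)) := by positivity
  have hKB' : 0 ≤ K' * (βf * B * (t - s)) := by positivity
  rw [abs_sub_le_iff]
  constructor
  · rw [sub_le_comm]
    refine le_valueFunction hP hU htT fun u x h => ?_
    obtain ⟨v, hv⟩ := hU
    -- An input on `[t, T]` becomes a competitor on `[s, T]` by prepending an arbitrary constant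
    -- control.
    set u' : ℝ → Vec m := fun r => if r < t then v else u r with hu'
    have hu'u : ∀ r ∈ Icc t P.T, u' r = u r := fun r hr => if_neg (not_lt.2 hr.1)
    have hmem' : ∀ r ∈ Icc s P.T, u' r ∈ P.U := fun r hr => by
      by_cases hrt : r < t
      · simpa [hu', hrt] using hv
      · rw [hu'u r ⟨not_lt.1 hrt, hr.2⟩]
        exact h.mem r ⟨not_lt.1 hrt, hr.2⟩
    have hmeas' : AEMeasurable u' (volume.restrict (Icc s P.T)) := by
      have h1 : AEMeasurable u' (volume.restrict (Ico s t)) :=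
        (aemeasurable_const (b := v)).congr <| by
          filter_upwards [ae_restrict_mem measurableSet_Ico] with r hr
          exact (if_pos hr.2).symm
      have h2 : AEMeasurable u' (volume.restrict (Icc t P.T)) :=
        h.measurable.congr <| by
          filter_upwards [ae_restrict_mem measurableSet_Icc] with r hr
          exact (hu'u r hr).symm
      rw [← Ico_union_Icc_eq_Icc ht.1 ht.2]
      exact aemeasurable_union_iff.2 ⟨h1, h2⟩
    obtain ⟨y, hy⟩ := exists_admissible hP hs hmeas' hmem' x₀
    have hyt := hy.restrict ht
    have hyu : P.Admissible (y t) t u y :=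
      { measurable := h.measurable
        mem := h.mem
        continuous := hyt.continuous
        integrable := hyt.integrable.congr fun r hr => by
          rw [uIoc_of_le ht.2] at hr
          simp only [hu'u r ⟨hr.1.le, hr.2⟩]
        eq := fun r hr => (hyt.eq r hr).trans <| by
          congr 1
          refine intervalIntegral.integral_congr fun q hq => ?_
          rw [uIcc_of_le hr.1] at hq
          simp only [hu'u q ⟨hq.1, hq.2.trans hr.2⟩] }
    have hceq : P.cost t u' y = P.cost t u y := by
      rw [cost, cost]
      congr 1
      refine intervalIntegral.integral_congr fun q hq => ?_
      rw [uIcc_of_le ht.2] at hq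
      simp only [hu'u q hq]
    have h1 := hy.valueFunction_le hP hs
    rw [hy.cost_eq_add hP hs ht, hceq] at h1
    have h2 := hcost t htT _ _ u y x hyu h
    have h3 := mul_le_mul_of_nonneg_left (hmove _ _ hy) hK
    have h4 := (abs_le.1 (hint _ _ hy)).2
    nlinarith
  · rw [sub_le_iff_le_add, ← sub_le_iff_le_add']
    refine le_valueFunction hP hU hs fun u x h => ?_
    have h1 := h.valueFunction_add_le_cost hP hs ht
    have h2 := hV t htT x₀ (x t)
    rw [norm_sub_rev] at h2
    have h3 := mul_le_mul_of_nonneg_left (hmove _ _ h) hK'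
    have h4 := (abs_le.1 (hint _ _ h)).1
    nlinarith

/-- The value function is Lipschitz on bounded sets. -/
theorem exists_valueFunction_lipschitzOnWith (hP : P.IsClassL βf) (hU : P.U.Nonempty) (ρ : ℝ) :
    ∃ K : NNReal, LipschitzOnWith K P.valueFunction (Metric.closedBall 0 ρ ×ˢ Icc 0 P.T) := by
  obtain ⟨K, hK, hx⟩ := exists_valueFunction_lipschitz_space hP hU
  obtain ⟨K', hK', ht⟩ := exists_valueFunction_lipschitz_time hP hU ρ
  refine ⟨Real.toNNReal (K + K'), LipschitzOnWith.of_le_add_mul _ ?_⟩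
  rintro ⟨x, s⟩ ⟨hxρ, hs⟩ ⟨y, t⟩ ⟨hyρ, htT⟩
  simp only [mem_closedBall_zero_iff] at hxρ hyρ
  rw [Real.coe_toNNReal _ (add_nonneg hK hK'), Prod.dist_eq]
  have h1 := hx s hs x y
  have h2 : P.valueFunction (y, s) - P.valueFunction (y, t) ≤ K' * |s - t| := by
    rcases le_total s t with h | h
    · have := (abs_le.1 (ht s hs t ⟨h, htT.2⟩ y hyρ)).2
      rwa [abs_sub_comm, abs_of_nonneg (sub_nonneg.2 h)]
    · have := (abs_le.1 (ht t htT s ⟨h, hs.2⟩ y hyρ)).1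
      rw [abs_of_nonneg (sub_nonneg.2 h)]
      linarith
  simp only at *
  rw [dist_eq_norm, Real.dist_eq]
  have h3 := mul_le_mul_of_nonneg_left (le_max_left ‖x - y‖ |s - t|) hK
  have h4 := mul_le_mul_of_nonneg_left (le_max_right ‖x - y‖ |s - t|) hK'
  linarith

end OCP

/-! ### The Hamilton-Jacobi-Bellman inequality and the cost identity. -/

namespace OCP

/-- Uniformity in a compact parameter of a strict lower bound. -/
theorem _root_.ContinuousOn.eventually_forall_lt {X Y : Type*} [TopologicalSpace X]
    [TopologicalSpace Y] {A : Set X} {U : Set Y} (hU : IsCompact U) {G : X × Y → ℝ}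
    (hG : ContinuousOn G (A ×ˢ U)) {z₀ : X} (hz₀ : z₀ ∈ A) {r : ℝ} (h : ∀ u ∈ U, r < G (z₀, u)) :
    ∀ᶠ z in 𝓝 z₀, z ∈ A → ∀ u ∈ U, r < G (z, u) := by
  have := hU.eventually_forall_of_forall_eventually (x₀ := z₀)
    (P := fun z u => z ∈ A → u ∈ U → r < G (z, u)) fun u hu => by
      have h1 := (hG (z₀, u) ⟨hz₀, hu⟩).eventually (lt_mem_nhds (h u hu))
      rw [eventually_nhdsWithin_iff] at h1
      filter_upwards [h1] with p hp hp1 hp2 using hp ⟨hp1, hp2⟩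
  filter_upwards [this] with z hz hzA u hu using hz u hu hzA hu

variable {n m : ℕ} {P : OCP n m} {βf : ℝ}

theorem IsClassL.continuousOn_f (hP : P.IsClassL βf) :
    ContinuousOn (fun p : (Vec n × ℝ) × Vec m => P.f p.1.2 p.1.1 p.2)
      ((univ ×ˢ Icc 0 P.T) ×ˢ P.U) :=
  hP.f_cont.comp (f := fun p : (Vec n × ℝ) × Vec m => (p.1.2, p.1.1, p.2))
    (by fun_prop) fun _ hp => ⟨hp.1.2, mem_univ _, hp.2⟩

theorem IsClassL.continuousOn_c (hP : P.IsClassL βf) :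
    ContinuousOn (fun p : (Vec n × ℝ) × Vec m => P.c p.1.2 p.1.1 p.2)
      ((univ ×ˢ Icc 0 P.T) ×ˢ P.U) :=
  hP.c_cont.comp (f := fun p : (Vec n × ℝ) × Vec m => (p.1.2, p.1.1, p.2))
    (by fun_prop) fun _ hp => ⟨hp.1.2, mem_univ _, hp.2⟩

/-- At a point of differentiability the value function satisfies the inequality `≤` of the
Hamilton-Jacobi-Bellman equation. -/
theorem exists_hjb_nonpos (hP : P.IsClassL βf) (hU : P.U.Nonempty) {x₀ : Vec n} {t₀ : ℝ}
    (ht₀ : t₀ ∈ Ico 0 P.T) {L : Vec n × ℝ →L[ℝ] ℝ}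
    (hL : HasFDerivAt P.valueFunction L (x₀, t₀)) :
    ∃ u ∈ P.U, P.c t₀ x₀ u + L (P.f t₀ x₀ u, 1) ≤ 0 := by
  -- Otherwise compactness gives a uniform `ε` below the Hamiltonian near `(x₀, t₀)`. Every
  -- trajectory over a short time `η` then has running cost plus increment of `V*` at least `ε η /
  -- 2`, which forces `V* ≥ V* + ε η / 2` at `(x₀, t₀)`. No optimal control is needed.
  by_contra! hcon
  set G : (Vec n × ℝ) × Vec m → ℝ :=
    fun p => P.c p.1.2 p.1.1 p.2 + L (P.f p.1.2 p.1.1 p.2, 1) with hG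
  have hGc : ContinuousOn G ((univ ×ˢ Icc 0 P.T) ×ˢ P.U) :=
    hP.continuousOn_c.add (L.continuous.comp_continuousOn
      (hP.continuousOn_f.prodMk continuousOn_const))
  have ht₀' : t₀ ∈ Icc 0 P.T := Ico_subset_Icc_self ht₀
  obtain ⟨v, hv, hvmin⟩ := hP.U_compact.exists_isMinOn hU
    (f := fun u => G ((x₀, t₀), u)) (hGc.comp (by fun_prop) fun u hu => ⟨⟨mem_univ _, ht₀'⟩, hu⟩)
  obtain ⟨ε, hε, hεv⟩ : ∃ ε, 0 < ε ∧ ε < G ((x₀, t₀), v) := exists_between (hcon v hv)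
  have hunif := hGc.eventually_forall_lt hP.U_compact (z₀ := (x₀, t₀)) ⟨mem_univ _, ht₀'⟩
    (r := ε) fun u hu => hεv.trans_le (hvmin hu)
  have hβf := hP.βf_pos
  set M₀ := βf * ((1 + ‖x₀‖) * Real.exp (βf * P.T)) with hM₀
  have hM₀pos : 0 < M₀ := by positivity
  -- `M` bounds the speed of `s ↦ (x s, s)` in the max norm, for all inputs at once. The tolerance
  -- `ε / (2M)` then costs at most half of the gain `ε η`.
  set M := M₀ + 1 with hM
  have hMpos : 0 < M := by positivity
  have hlin := hL.isLittleO.def (c := ε / (2 * M)) (by positivity)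
  obtain ⟨δ, hδ, hball⟩ := Metric.eventually_nhds_iff.1 (hunif.and hlin)
  set η := min (P.T - t₀) (δ / (2 * M)) with hη
  have hηpos : 0 < η := lt_min (sub_pos.2 ht₀.2) (by positivity)
  have hηδ : M * η < δ := by
    have := mul_le_mul_of_nonneg_left (min_le_right (P.T - t₀) (δ / (2 * M))) hMpos.le
    have h2 : M * (δ / (2 * M)) = δ / 2 := by field_simp
    rw [h2] at this
    exact this.trans_lt (by linarith)
  have ht₁ : t₀ + η ∈ Icc t₀ P.T :=
    ⟨by linarith, by linarith [min_le_left (P.T - t₀) (δ / (2 * M))]⟩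
  have hmain : P.valueFunction (x₀, t₀) + ε * η / 2 ≤ P.valueFunction (x₀, t₀) := by
    refine le_valueFunction hP hU ht₀' fun u x h => ?_
    have hnear : ∀ s ∈ Icc t₀ (t₀ + η), ‖(x s, s) - (x₀, t₀)‖ ≤ M * η := fun s hs => by
      have hsT : s ∈ Icc t₀ P.T := ⟨hs.1, hs.2.trans ht₁.2⟩
      have h1 := h.norm_sub_le hP ht₀.1 ⟨le_rfl, ht₀.2.le⟩ hsT
      have h2 : |s - t₀| ≤ η := by
        rw [abs_of_nonneg (sub_nonneg.2 hs.1)]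
        linarith [hs.2]
      rw [h.apply_left ht₀.2.le] at h1
      rw [Prod.mk_sub_mk, Prod.norm_mk, Real.norm_eq_abs]
      refine max_le (h1.trans ?_) (h2.trans ?_)
      · exact mul_le_mul (by linarith) h2 (abs_nonneg _) hMpos.le
      · nlinarith
    have hd : ∀ s ∈ Icc t₀ (t₀ + η), dist (x s, s) (x₀, t₀) < δ := fun s hs => by
      rw [dist_eq_norm]
      exact (hnear s hs).trans_lt hηδ
    have hl : t₀ ∈ Icc t₀ P.T := ⟨le_rfl, ht₀.2.le⟩
    have hfi := h.integrable.mono_Icc hl ht₁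
    have hci := (h.intervalIntegrable_cost hP ht₀').mono_Icc hl ht₁
    set A : Vec n →L[ℝ] ℝ := L.comp (ContinuousLinearMap.inl ℝ (Vec n) ℝ) with hA
    have hLs : ∀ (y : Vec n) (s : ℝ), L (y, s) = A y + s * L (0, 1) := fun y s => by
      have : (y, s) = (y, (0 : ℝ)) + s • ((0 : Vec n), (1 : ℝ)) := by simp
      rw [this, map_add, map_smul]
      simp [hA]
    have hAi : IntervalIntegrable (fun s => A (P.f s (x s) (u s))) volume t₀ (t₀ + η) :=
      ⟨A.integrable_comp hfi.1, A.integrable_comp hfi.2⟩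
    -- The displacement is the integral of `(f, 1)`, and `L` commutes with the integral, so a
    -- pointwise lower bound on the integrand suffices.
    have hint : ε * η ≤ (∫ s in t₀..(t₀ + η), P.c s (x s) (u s)) +
        L (x (t₀ + η) - x₀, η) := by
      have e1 : L (x (t₀ + η) - x₀, η) =
          ∫ s in t₀..(t₀ + η), (A (P.f s (x s) (u s)) + L (0, 1)) := by
        have := h.sub_eq hl ht₁
        rw [h.apply_left ht₀.2.le] at this
        rw [intervalIntegral.integral_add hAi intervalIntegrable_const, hLs,
          A.intervalIntegral_comp_comm hfi, this]
        simp
      rw [e1, ← intervalIntegral.integral_add hci (hAi.add intervalIntegrable_const)]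
      have e2 : ε * η = ∫ _ in t₀..(t₀ + η), ε := by simp [mul_comm]
      rw [e2]
      refine intervalIntegral.integral_mono_on ht₁.1 intervalIntegrable_const
        (hci.add (hAi.add intervalIntegrable_const)) fun s hs => ?_
      have hsT : s ∈ Icc t₀ P.T := ⟨hs.1, hs.2.trans ht₁.2⟩
      have := (hball (hd s hs)).1 ⟨mem_univ _, ht₀.1.trans hsT.1, hsT.2⟩ (u s) (h.mem s hsT)
      simp only [hG] at this
      rw [hLs, one_mul] at this
      exact this.le
    have hs₁ : t₀ + η ∈ Icc t₀ (t₀ + η) := ⟨by linarith, le_rfl⟩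
    have hV := (hball (hd _ hs₁)).2
    have hV' := hV.trans (mul_le_mul_of_nonneg_left (hnear _ hs₁) (by positivity))
    have e3 : ε / (2 * M) * (M * η) = ε * η / 2 := by field_simp
    rw [e3, Real.norm_eq_abs, Prod.mk_sub_mk, add_sub_cancel_left] at hV'
    have h4 := h.valueFunction_add_le_cost hP ht₀' ht₁
    linarith [(abs_le.1 hV').1]
  have : 0 < ε * η := mul_pos hε hηpos
  linarith

/-- The cost of an admissible pair in terms of a continuously differentiable function `J`. -/
theorem Admissible.cost_eq_of_contDiff {x₀ : Vec n} {u : ℝ → Vec m} {x : ℝ → Vec n}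
    (h : P.Admissible x₀ 0 u x) (hP : P.IsClassL βf) {J : Vec n × ℝ → ℝ} (hJ : ContDiff ℝ 1 J) :
    IntervalIntegrable (fun t => P.c t (x t) (u t) + fderiv ℝ J (x t, t) (P.f t (x t) (u t), 1))
      volume 0 P.T ∧
    P.cost 0 u x = J (x₀, 0) - J (x P.T, P.T) + P.g (x P.T) +
      ∫ t in 0..P.T, (P.c t (x t) (u t) + fderiv ℝ J (x t, t) (P.f t (x t) (u t), 1)) := by
  have hT := hP.T_pos
  have h0 : (0 : ℝ) ∈ Icc 0 P.T := ⟨le_rfl, hT.le⟩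
  have hβf := hP.βf_pos
  set B := (1 + ‖x₀‖) * Real.exp (βf * P.T) with hB
  have hBpos : 0 < B := by positivity
  obtain ⟨K, hK⟩ := (hJ.contDiffOn (s := Metric.closedBall 0 B ×ˢ Icc 0 P.T)).exists_lipschitzOnWith
    one_ne_zero ((convex_closedBall _ _).prod (convex_Icc _ _))
    ((isCompact_closedBall _ _).prod isCompact_Icc)
  have hmaps : MapsTo (fun t => (x t, t)) (Icc 0 P.T) (Metric.closedBall 0 B ×ˢ Icc 0 P.T) := by
    intro t ht
    refine ⟨?_, ht⟩
    rw [mem_closedBall_zero_iff]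
    linarith [h.one_add_norm_le hP le_rfl ht]
  have hxl : LipschitzOnWith (Real.toNNReal (βf * B)) x (Icc 0 P.T) :=
    LipschitzOnWith.of_dist_le_mul fun s hs t ht => by
      rw [Real.coe_toNNReal _ (by positivity), dist_eq_norm, Real.dist_eq]
      exact h.norm_sub_le hP le_rfl ht hs
  -- For a merely measurable input the chain rule holds only almost everywhere. Lipschitz continuity
  -- of `t ↦ J (x t, t)` supplies the absolute continuity that the fundamental theorem requires.
  have hAC : AbsolutelyContinuousOnInterval (fun t => J (x t, t)) 0 P.T := by
    have := hK.comp (hxl.prodMk (LipschitzWith.id.lipschitzOnWith (s := Icc 0 P.T))) hmaps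
    rw [← uIcc_of_le hT.le] at this
    exact this.absolutelyContinuousOnInterval
  have hder : ∀ᵐ t, t ∈ uIoc 0 P.T → deriv (fun t => J (x t, t)) t =
      fderiv ℝ J (x t, t) (P.f t (x t) (u t), 1) := by
    filter_upwards [h.integrable.ae_hasDerivAt_integral, Measure.ae_ne volume P.T]
      with t ht hne htT
    rw [uIoc_of_le hT.le] at htT
    have htI : t ∈ Ioo 0 P.T := ⟨htT.1, htT.2.lt_of_ne hne⟩
    have h1 := (ht (by rw [uIcc_of_le hT.le]; exact Ioo_subset_Icc_self htI) 0
      (by rw [uIcc_of_le hT.le]; exact h0)).const_add x₀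
    have h2 : HasDerivAt x (P.f t (x t) (u t)) t := h1.congr_of_eventuallyEq <| by
      filter_upwards [isOpen_Ioo.mem_nhds htI] with s hs using h.eq s (Ioo_subset_Icc_self hs)
    exact ((hJ.differentiable one_ne_zero _).hasFDerivAt.comp_hasDerivAt t
      (h2.prodMk (hasDerivAt_id t))).deriv
  have hci := h.intervalIntegrable_cost hP h0
  have hJi : IntervalIntegrable (fun t => fderiv ℝ J (x t, t) (P.f t (x t) (u t), 1))
      volume 0 P.T :=
    hAC.intervalIntegrable_deriv.congr_ae <| (ae_restrict_iff' measurableSet_uIoc).2 hder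
  refine ⟨hci.add hJi, ?_⟩
  have hFTC := hAC.integral_deriv_eq_sub
  rw [intervalIntegral.integral_congr_ae hder, h.apply_left hT.le] at hFTC
  rw [intervalIntegral.integral_add hci hJi, hFTC, cost]
  ring

end OCP

/-! ### The Hamiltonian along the feedback trajectory and the final estimate. -/

namespace OCP

variable {n m : ℕ} {P : OCP n m} {βf : ℝ}

/-- The Hamiltonian of `J` is bounded above by the size of the derivatives of `J - V`, at every
cluster point of the points where `V` is differentiable. -/
theorem exists_hamiltonian_le (hP : P.IsClassL βf) (hU : P.U.Nonempty) {J : Vec n × ℝ → ℝ}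
    (hJ : ContDiff ℝ 1 J) {R S N : ℝ} (hS : 0 ≤ S) {z : Vec n × ℝ} (hz : z.2 ∈ Icc 0 P.T)
    (hcl : z ∈ closure {y : Vec n × ℝ | y ∈ Metric.ball 0 R ×ˢ Ioo 0 P.T ∧
      DifferentiableAt ℝ (fun y => J y - P.valueFunction y) y ∧
      (∀ v : Vec n, |fderiv ℝ (fun y => J y - P.valueFunction y) y (v, 0)| ≤ ‖v‖ * S) ∧
      |fderiv ℝ (fun y => J y - P.valueFunction y) y (0, 1)| ≤ N}) :
    ∃ u ∈ P.U, P.c z.2 z.1 u + fderiv ℝ J z (P.f z.2 z.1 u, 1) ≤ βf * (1 + R) * S + N := by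
  -- A strict lower bound valid for all `u` at `z` persists, uniformly in `u`, at nearby points. One
  -- of these is a point of differentiability, where `exists_hjb_nonpos` contradicts it.
  by_contra! hcon
  have hGc : ContinuousOn (fun p : (Vec n × ℝ) × Vec m =>
      P.c p.1.2 p.1.1 p.2 + fderiv ℝ J p.1 (P.f p.1.2 p.1.1 p.2, 1))
      ((univ ×ˢ Icc 0 P.T) ×ˢ P.U) :=
    hP.continuousOn_c.add (((hJ.continuous_fderiv one_ne_zero).comp continuous_fst).continuousOn
      |>.clm_apply (hP.continuousOn_f.prodMk continuousOn_const))
  have hev := hGc.eventually_forall_lt hP.U_compact (z₀ := z) ⟨mem_univ _, hz⟩ hcon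
  obtain ⟨y, hy, ⟨hyR, hyT⟩, hd, hsp, ht⟩ := mem_closure_iff_nhds.1 hcl _ hev
  have hJd := (hJ.differentiable one_ne_zero y).hasFDerivAt
  have hV : HasFDerivAt P.valueFunction
      (fderiv ℝ J y - fderiv ℝ (fun y => J y - P.valueFunction y) y) (y.1, y.2) := by
    have := hJd.sub hd.hasFDerivAt
    simpa [Pi.sub_def] using this
  obtain ⟨u, hu, hle⟩ := exists_hjb_nonpos hP hU ⟨hyT.1.le, hyT.2⟩ hV
  have hlt := hy ⟨mem_univ _, Ioo_subset_Icc_self hyT⟩ u hu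
  have hf : ‖P.f y.2 y.1 u‖ ≤ βf * (1 + R) :=
    (hP.f_growth _ (Ioo_subset_Icc_self hyT) u hu _).trans
      (mul_le_mul_of_nonneg_left (by linarith [mem_ball_zero_iff.1 hyR]) hP.βf_pos.le)
  have hsplit : (P.f y.2 y.1 u, (1 : ℝ)) = (P.f y.2 y.1 u, 0) + (0, 1) := by simp
  rw [sub_apply] at hle
  have h1 := (le_abs_self _).trans ((hsp (P.f y.2 y.1 u)).trans (mul_le_mul_of_nonneg_right hf hS))
  have h2 := (le_abs_self _).trans ht
  have h3 : fderiv ℝ (fun y => J y - P.valueFunction y) y (P.f y.2 y.1 u, 1) ≤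
      βf * (1 + R) * S + N := by
    rw [hsplit, map_add]
    exact add_le_add h1 h2
  linarith

/-- The time derivative of `J` does not depend on the control, so adding it leaves the minimizer
unchanged. -/
theorem IsFeedback.isMinOn {J : Vec n × ℝ → ℝ} {k : Vec n → ℝ → Vec m} (hk : P.IsFeedback J k)
    (hJ : Differentiable ℝ J) {x : Vec n} {t : ℝ} (ht : t ∈ Icc 0 P.T) :
    IsMinOn (fun v => P.c t x v + fderiv ℝ J (x, t) (P.f t x v, 1)) P.U (k x t) := by
  intro v hv
  have hgrad : ∀ y : Vec n, inner ℝ (gradient (fun y => J (y, t)) x) y =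
      fderiv ℝ J (x, t) (y, 0) := fun y => by
    have h : HasFDerivAt (fun y => J (y, t))
        ((fderiv ℝ J (x, t)).comp (ContinuousLinearMap.inl ℝ (Vec n) ℝ)) x :=
      (hJ (x, t)).hasFDerivAt.comp x (hasFDerivAt_prodMk_left x t)
    rw [inner_gradient_left, h.fderiv]
    simp
  have hsplit : ∀ y : Vec n, fderiv ℝ J (x, t) (y, 1) =
      fderiv ℝ J (x, t) (y, 0) + fderiv ℝ J (x, t) (0, 1) := fun y => by
    rw [← map_add]
    simp
  have h : P.c t x (k x t) + inner ℝ (gradient (fun y => J (y, t)) x) (P.f t x (k x t)) ≤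
    P.c t x v + inner ℝ (gradient (fun y => J (y, t)) x) (P.f t x v) := (hk x t ht).2 hv
  rw [hgrad, hgrad] at h
  change P.c t x (k x t) + fderiv ℝ J (x, t) (P.f t x (k x t), 1) ≤
    P.c t x v + fderiv ℝ J (x, t) (P.f t x v, 1)
  rw [hsplit (P.f t x (k x t)), hsplit (P.f t x v)]
  linarith

end OCP

theorem theorem2 {n m : ℕ} (P : OCP n m) (βf : ℝ) (hP : P.IsClassL βf)
    (J : Vec n × ℝ → ℝ) (hJ : ContDiff ℝ 2 J) (x₀ : Vec n)
    (kJ : Vec n → ℝ → Vec m) (hk : P.IsFeedback J kJ)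
    (uJ : ℝ → Vec m) (xJ : ℝ → Vec n) (hadm : P.Admissible x₀ 0 uJ xJ)
    (huJ : ∀ t ∈ Set.Icc 0 P.T, uJ t = kJ (xJ t) t)
    (C R : ℝ)
    (hC : C = 2 * max 1 (max P.T (P.T * βf * (1 + ‖x₀‖) * Real.exp (βf * P.T))))
    (hR : R = (1 + ‖x₀‖) * Real.exp (βf * P.T) - 1) :
    MemW1Inf (Metric.ball 0 R ×ˢ Set.Icc 0 P.T) (fun z => J z - P.valueFunction z) ∧
    P.optimalityGap uJ xJ x₀ ≤
      C * w1InfNorm (Metric.ball 0 R ×ˢ Set.Icc 0 P.T) (fun z => J z - P.valueFunction z) := by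
  have hT := hP.T_pos
  have hβf := hP.βf_pos
  have h0 : (0 : ℝ) ∈ Icc 0 P.T := ⟨le_rfl, hT.le⟩
  have hU : P.U.Nonempty := ⟨_, hadm.mem 0 h0⟩
  have hJ1 : ContDiff ℝ 1 J := hJ.of_le one_le_two
  have hexp : 1 < Real.exp (βf * P.T) := Real.one_lt_exp_iff.2 (by positivity)
  have hRpos : 0 < R := by nlinarith [norm_nonneg x₀]
  set w : Vec n × ℝ → ℝ := fun z => J z - P.valueFunction z with hw
  set Q : Set (Vec n × ℝ) := Metric.closedBall 0 R ×ˢ Icc 0 P.T with hQ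
  obtain ⟨K, hK⟩ := (hJ1.contDiffOn (s := Q)).exists_lipschitzOnWith one_ne_zero
    ((convex_closedBall _ _).prod (convex_Icc _ _))
    ((isCompact_closedBall _ _).prod isCompact_Icc)
  obtain ⟨K', hK'⟩ := OCP.exists_valueFunction_lipschitzOnWith hP hU R
  have hwQ : LipschitzOnWith (K + K') w Q := hK.sub hK'
  have hint : interior (Metric.ball (0 : Vec n) R ×ˢ Icc 0 P.T) =
      Metric.ball 0 R ×ˢ Ioo 0 P.T := by
    rw [interior_prod_eq, Metric.isOpen_ball.interior_eq, interior_Icc]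
  have hnull : (Metric.ball (0 : Vec n) R ×ˢ Icc 0 P.T : Set (Vec n × ℝ)) =ᵐ[volume]
      interior (Metric.ball (0 : Vec n) R ×ˢ Icc 0 P.T) :=
    (interior_ae_eq_of_null_frontier (((convex_ball _ _).prod (convex_Icc _ _)).addHaar_frontier
      volume)).symm
  obtain ⟨hmem, N₀, S, N₁, hN₀, hS, hN₁, hnorm, hae⟩ :=
    (hwQ.mono (prod_mono_left Metric.ball_subset_closedBall)).memW1Inf
      (Metric.isBounded_ball.prod (Metric.isBounded_Icc _ _)) hnull
  refine ⟨hmem, ?_⟩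
  rw [hint, ae_restrict_iff' (Metric.isOpen_ball.prod isOpen_Ioo).measurableSet] at hae
  -- A set of full measure is dense, so the good points in the open cylinder accumulate at every
  -- point of the closed cylinder `Q`, including its boundary, which the trajectory may touch.
  have hdense := (Measure.dense_of_ae hae).open_subset_closure_inter
    ((Metric.isOpen_ball (x := 0) (ε := R)).prod (isOpen_Ioo (a := 0) (b := P.T)))
  have hcl := closure_minimal hdense isClosed_closure
  rw [closure_prod_eq, closure_ball _ hRpos.ne', closure_Ioo hT.ne] at hcl
  -- Continuity turns the essential bound into a pointwise one, needed at both endpoints of the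
  -- trajectory.
  have hval : ∀ z ∈ Q, |w z| ≤ N₀ := fun z hz => by
    have hclosed : IsClosed (Q ∩ w ⁻¹' {r | |r| ≤ N₀}) :=
      hwQ.continuousOn.preimage_isClosed_of_isClosed
        (Metric.isClosed_closedBall.prod isClosed_Icc) (isClosed_le continuous_abs continuous_const)
    refine (closure_minimal ?_ hclosed (hcl hz)).2
    rintro y ⟨hyO, hy⟩
    exact ⟨prod_mono Metric.ball_subset_closedBall Ioo_subset_Icc_self hyO, (hy hyO).2.1⟩
  have hham : ∀ t ∈ Ioo 0 P.T, P.c t (xJ t) (uJ t) +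
      fderiv ℝ J (xJ t, t) (P.f t (xJ t) (uJ t), 1) ≤ βf * (1 + R) * S + N₁ := fun t ht => by
    have htI := Ioo_subset_Icc_self ht
    have hxQ : (xJ t, t) ∈ Q := by
      refine ⟨?_, htI⟩
      rw [mem_closedBall_zero_iff]
      linarith [hadm.one_add_norm_le hP le_rfl htI]
    obtain ⟨u, hu, hle⟩ := OCP.exists_hamiltonian_le hP hU hJ1 (R := R) (N := N₁) hS
      (z := (xJ t, t)) htI (by
        refine closure_mono ?_ (hcl hxQ)
        rintro y ⟨hyO, hy⟩
        exact ⟨hyO, (hy hyO).1, (hy hyO).2.2⟩)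
    rw [huJ t htI]
    exact (hk.isMinOn (hJ1.differentiable one_ne_zero) htI hu).trans hle
  obtain ⟨hi, hcost⟩ := hadm.cost_eq_of_contDiff hP hJ1
  have hmono := intervalIntegral.integral_mono_on_of_le_Ioo hT.le hi
    (intervalIntegrable_const (μ := volume)) hham
  rw [intervalIntegral.integral_const, smul_eq_mul, sub_zero] at hmono
  have hstart : |w (x₀, 0)| ≤ N₀ := by
    have := hval (xJ 0, 0) ⟨by
      rw [mem_closedBall_zero_iff]
      linarith [hadm.one_add_norm_le hP le_rfl h0], h0⟩
    rwa [hadm.apply_left hT.le] at this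
  have hTI : P.T ∈ Icc 0 P.T := ⟨hT.le, le_rfl⟩
  have hend : |w (xJ P.T, P.T)| ≤ N₀ := hval _ ⟨by
      rw [mem_closedBall_zero_iff]
      linarith [hadm.one_add_norm_le hP le_rfl hTI], hTI⟩
  simp only [hw] at hstart hend
  rw [OCP.valueFunction_terminal hP hU] at hend
  have hgap : P.optimalityGap uJ xJ x₀ ≤ 2 * N₀ + P.T * (βf * (1 + R) * S + N₁) := by
    rw [OCP.optimalityGap, hcost]
    linarith [(abs_le.1 hstart).2, (abs_le.1 hend).1]
  refine hgap.trans ?_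
  rw [hnorm, hC]
  -- The three entries of the maximum dominate the coefficients of `N₀` (after extracting 2), `N₁`
  -- and `S`; the last one is `T βf (1 + R)`. The factor 2 comes from the two endpoint values of
  -- `w`.
  set D := max 1 (max P.T (P.T * βf * (1 + ‖x₀‖) * Real.exp (βf * P.T))) with hD
  have d1 : 1 ≤ D := le_max_left _ _
  have d2 : P.T ≤ D := (le_max_left _ _).trans (le_max_right _ _)
  have d3 : P.T * (βf * (1 + R)) ≤ D := by
    refine le_trans (le_of_eq ?_) ((le_max_right _ _).trans (le_max_right _ _))
    rw [hR]
    ring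
  have k1 := mul_le_mul_of_nonneg_right d1 hN₀
  have k2 := mul_le_mul_of_nonneg_right d2 hN₁
  have k3 := mul_le_mul_of_nonneg_right d3 hS
  have k4 : 0 ≤ D * S := mul_nonneg (by linarith) hS
  have k5 : 0 ≤ D * N₁ := mul_nonneg (by linarith) hN₁
  linarith
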